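/- Let $G$ be a finite simple connected graph on $n \ge 3$ vertices. Let $d_1(G) \ge d_2(G) \ge \dots \ge d_n(G)$ be the degrees of its vertices in non-increasing order, and let $\mu_1(G) \ge \mu_2(G) \ge \dots \ge \mu_n(G)$ be the eigenvalues, listed with multiplicity, of its Laplacian matrix $L = D - A$, where $A$ is the adjacency matrix of $G$ and $D$ is the diagonal matrix of its vertex degrees. Then $$\mu_1(G)+\mu_2(G) \ge d_1(G)+d_2(G)+1,$$ with equality if and only if $G$ is (isomorphic to) the star $S_n$, that is, some vertex of $G$ is adjacent to all the other $n-1$ vertices and $G$ has no further edges. -/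

import Mathlib

namespace SimpleGraph

variable {V : Type*} [Fintype V] (G : SimpleGraph V) [DecidableRel G.Adj]

/-- The list of all vertex degrees of `G`, with multiplicity, in non-increasing order. -/
def degreeList : List ℕ :=
  (Finset.univ.val.map fun v => G.degree v).sort (· ≥ ·)

theorem length_degreeList : G.degreeList.length = Fintype.card V := by
  simp [degreeList]

/-- The degree sequence `d₁ ≥ d₂ ≥ … ≥ dₙ` of `G`, indexed from `0`. -/
def degreeSeq (i : Fin (Fintype.card V)) : ℕ :=
  G.degreeList.get (i.cast G.length_degreeList.symm)

/-- The eigenvalues `μ₁ ≥ μ₂ ≥ … ≥ μₙ` of the Laplacian matrix of `G`, with multiplicity,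
in non-increasing order, indexed from `0`. -/
noncomputable def laplacianEigenvalue [DecidableEq V] (i : Fin (Fintype.card V)) : ℝ :=
  (G.isHermitian_lapMatrix ℝ).eigenvalues₀ i

end SimpleGraph

/-!
Write the Laplacian as `L = B Bᵀ` with `B` the oriented incidence matrix. For orthonormal edge
vectors `z`, `w`, Bessel's inequality says that `(Bz)(Bz)ᵀ + (Bw)(Bw)ᵀ ≤ L`, so by Ky Fan's principle
`‖Bz‖² + ‖Bw‖² ≤ μ₁ + μ₂` (`le_laplacianEigenvalue_add`). The theorem follows by choosing edge
vectors at vertices `u`, `v` of the two largest degrees `D ≥ E`. The star at `u`, with all its edges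
oriented outwards, is an edge vector of squared norm `D` whose image under `B` is the row of `L` at
`u`, of squared norm `D² + D`; normalised, it contributes `D + 1`.

* If `u`, `v` are not adjacent, their stars are orthogonal and contribute `D + E + 2` in total
  (`degree_add_degree_add_two_le`).
* If they are adjacent and `E ≥ 2`, the star at `v` made orthogonal to the star at `u` contributes
  strictly more than `E` (`degree_add_degree_add_one_lt`).
* If `E = 1`, connectedness forces the graph to be the star centred at `u`
  (`Connected.eq_starGraph_of_degree_le_one`). The difference of two edges of the star contributes
  `1` (`degree_add_two_le`), and `μ₁ + μ₂ ≤ n + 1 = D + 2` by a direct estimate of the quadratic form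
  (`laplacianEigenvalue_add_le_of_starGraph`), so equality holds.

Hence equality occurs exactly when the second largest degree is `1`, that is, for stars. Edge vectors
do not appear in the formal statements: an edge vector `z` is represented by `Bz` and its squared
norm.
-/

namespace SimpleGraph

open Finset Matrix
open scoped InnerProductSpace

/-! ### A two-vector form of Ky Fan's principle -/

theorem sum_mul_le_add_of_antitone {n : ℕ} (hn : 2 ≤ n) {μ t : Fin n → ℝ} (hμ : Antitone μ)
    (h0 : ∀ i, 0 ≤ t i) (h1 : ∀ i, t i ≤ 1) (hsum : ∑ i, t i = 2) :
    ∑ i, μ i * t i ≤ μ ⟨0, by omega⟩ + μ ⟨1, by omega⟩ := by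
  set a : Fin n := ⟨0, by omega⟩
  set b : Fin n := ⟨1, by omega⟩
  have hab : μ b ≤ μ a := hμ (by simp [a, b, Fin.le_def])
  have key : ∑ i, (μ i - μ b) * t i ≤ ∑ i, if i = a then μ a - μ b else 0 := by
    refine sum_le_sum fun i _ => ?_
    split_ifs with h
    · subst h
      exact mul_le_of_le_one_right (by linarith) (h1 _)
    · have : b ≤ i := by
        rw [Fin.le_def]
        have : i.val ≠ 0 := fun h' => h (Fin.ext h')
        simp only [b]
        omega
      exact mul_nonpos_of_nonpos_of_nonneg (by linarith [hμ this]) (h0 i)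
  simp only [sub_mul, sum_sub_distrib, ← mul_sum, hsum, sum_ite_eq', mem_univ, if_true] at key
  linarith

/-- If the rank two form `x xᵀ + y yᵀ` is dominated by the form with eigenbasis `b` and eigenvalues
`μ`, then its trace is at most the sum of the two largest eigenvalues. Indeed the trace is attained
on two orthonormal vectors whose span contains `x` and `y`, and on any two orthonormal vectors Ky
Fan's principle bounds the dominating form by the two largest eigenvalues. -/
theorem norm_sq_add_norm_sq_le_of_inner_sq_le {E : Type*} [NormedAddCommGroup E]
    [InnerProductSpace ℝ E] [FiniteDimensional ℝ E] {n : ℕ} (hn : 2 ≤ n)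
    (b : OrthonormalBasis (Fin n) ℝ E) {μ : Fin n → ℝ} (hμ : Antitone μ) (x y : E)
    (h : ∀ f, ⟪x, f⟫_ℝ ^ 2 + ⟪y, f⟫_ℝ ^ 2 ≤ ∑ i, μ i * ⟪b i, f⟫_ℝ ^ 2) :
    ‖x‖ ^ 2 + ‖y‖ ^ 2 ≤ μ ⟨0, by omega⟩ + μ ⟨1, by omega⟩ := by
  set i₀ : Fin n := ⟨0, by omega⟩ with hi₀
  set i₁ : Fin n := ⟨1, by omega⟩ with hi₁
  have hne : i₀ ≠ i₁ := by simp [hi₀, hi₁]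
  have hcard : Module.finrank ℝ E = Fintype.card (Fin n) :=
    Module.finrank_eq_card_basis b.toBasis
  let F : Fin n → E := fun i => if i = i₀ then x else if i = i₁ then y else 0
  have hF₀ : F i₀ = x := by simp [F]
  have hF₁ : F i₁ = y := by simp [F, hne.symm]
  let c := InnerProductSpace.gramSchmidtOrthonormalBasis hcard F
  -- `x` and `y` lie in the span of the first two vectors of the Gram-Schmidt basis.
  have hlt : ∀ j, j ≠ i₀ → j ≠ i₁ → i₀ < j ∧ i₁ < j := by
    intro j h0 h1
    have h0' : j.val ≠ 0 := fun h' => h0 (Fin.ext h')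
    have h1' : j.val ≠ 1 := fun h' => h1 (Fin.ext h')
    simp only [Fin.lt_def, hi₀, hi₁]
    omega
  have norm_eq : ∀ z : E, (∀ j, j ≠ i₀ → j ≠ i₁ → ⟪c j, z⟫_ℝ = 0) →
      ‖z‖ ^ 2 = ⟪z, c i₀⟫_ℝ ^ 2 + ⟪z, c i₁⟫_ℝ ^ 2 := by
    intro z hz
    rw [← c.sum_sq_inner_left z]
    refine sum_eq_add i₀ i₁ hne (fun j _ hj => ?_) (by simp) (by simp)
    rw [real_inner_comm, hz j hj.1 hj.2]
    simp
  have hx := norm_eq x fun j h0 h1 => by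
    rw [← hF₀]
    exact InnerProductSpace.gramSchmidtOrthonormalBasis_inv_triangular hcard F (hlt j h0 h1).1
  have hy := norm_eq y fun j h0 h1 => by
    rw [← hF₁]
    exact InnerProductSpace.gramSchmidtOrthonormalBasis_inv_triangular hcard F (hlt j h0 h1).2
  have hnorm : ∀ j, ‖c j‖ = 1 := c.orthonormal.1
  -- Ky Fan's bound for the orthonormal pair `c i₀`, `c i₁`: the weights are at most `1` by Bessel's
  -- inequality for `b i` and sum to `2` by Parseval's identity.
  have htop := sum_mul_le_add_of_antitone hn hμ
    (t := fun i => ⟪b i, c i₀⟫_ℝ ^ 2 + ⟪b i, c i₁⟫_ℝ ^ 2) (fun i => by positivity)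
    (fun i => by
      have h1 := c.sum_sq_inner_left (b i)
      rw [b.orthonormal.1 i, one_pow] at h1
      rw [← h1, ← sum_pair (f := fun j => ⟪b i, c j⟫_ℝ ^ 2) hne]
      exact sum_le_sum_of_subset_of_nonneg (subset_univ _) fun _ _ _ => sq_nonneg _)
    (by
      rw [sum_add_distrib, b.sum_sq_inner_right, b.sum_sq_inner_right, hnorm, hnorm]
      norm_num)
  simp only [mul_add, sum_add_distrib] at htop
  linarith [h (c i₀), h (c i₁)]

/-! ### The quadratic form of the Laplacian -/

variable {V : Type*} [Fintype V] (G : SimpleGraph V) [DecidableRel G.Adj]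

/-- The quadratic form `∑_{ij ∈ E} (f i - f j) ^ 2` of the Laplacian, written as half the sum over
ordered pairs of adjacent vertices. -/
noncomputable def laplacianForm (f : V → ℝ) : ℝ :=
  (∑ i, ∑ j, if G.Adj i j then (f i - f j) ^ 2 else 0) / 2

/-- The part `∑ (f u - f x) ^ 2` of the Laplacian form carried by the edges `ux` at `u`. -/
def starForm (u : V) (f : V → ℝ) : ℝ := ∑ x ∈ G.neighborFinset u, (f u - f x) ^ 2

theorem sum_sub_sq_le (f : V → ℝ) (u : V) :
    (∑ x ∈ G.neighborFinset u, (f u - f x)) ^ 2 ≤ G.degree u * G.starForm u f := by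
  simpa [starForm] using
    sq_sum_le_card_mul_sum_sq (s := G.neighborFinset u) (f := fun x => f u - f x)

variable [DecidableEq V]

/-- In an orthonormal eigenbasis the quadratic form is diagonal, with the ordered eigenvalues as
coefficients. -/
theorem exists_orthonormalBasis_laplacianForm :
    ∃ b : OrthonormalBasis (Fin (Fintype.card V)) ℝ (EuclideanSpace ℝ V),
      ∀ f : EuclideanSpace ℝ V,
        G.laplacianForm f = ∑ i, G.laplacianEigenvalue i * ⟪b i, f⟫_ℝ ^ 2 := by
  have hA := G.isHermitian_lapMatrix ℝ
  have hT := isSymmetric_toEuclideanLin_iff.mpr hA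
  refine ⟨hT.eigenvectorBasis finrank_euclideanSpace, fun f => ?_⟩
  set b := hT.eigenvectorBasis finrank_euclideanSpace
  have h1 : G.laplacianForm f = ⟪f, (G.lapMatrix ℝ).toEuclideanLin f⟫_ℝ := by
    rw [laplacianForm, ← lapMatrix_toLinearMap₂', toLinearMap₂'_apply',
      EuclideanSpace.inner_eq_star_dotProduct, dotProduct_comm]
    simp [toLpLin_apply]
  rw [h1, ← b.sum_inner_mul_inner]
  refine sum_congr rfl fun i _ => ?_
  have h2 : ⟪b i, (G.lapMatrix ℝ).toEuclideanLin f⟫_ℝ = G.laplacianEigenvalue i * ⟪b i, f⟫_ℝ := by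
    rw [← hT, hT.apply_eigenvectorBasis, inner_smul_left]
    simp [laplacianEigenvalue, IsHermitian.eigenvalues₀, b]
  rw [h2, real_inner_comm]
  ring

/-- The two-vector bound for the Laplacian. The weights `p` and `q` spare the normalisation of `x`
and `y`: in the applications they are the squared norms of edge vectors, and `x`, `y` are the images
of these edge vectors under the oriented incidence matrix. -/
theorem le_laplacianEigenvalue_add (hn : 2 ≤ Fintype.card V) (x y : V → ℝ) {p q : ℝ}
    (hp : 0 < p) (hq : 0 < q)
    (h : ∀ f, (∑ v, x v * f v) ^ 2 / p + (∑ v, y v * f v) ^ 2 / q ≤ G.laplacianForm f) :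
    (∑ v, x v * x v) / p + (∑ v, y v * y v) / q ≤
      G.laplacianEigenvalue ⟨0, by omega⟩ + G.laplacianEigenvalue ⟨1, by omega⟩ := by
  obtain ⟨b, hb⟩ := G.exists_orthonormalBasis_laplacianForm
  have hinner : ∀ (z : V → ℝ) {r : ℝ}, 0 < r → ∀ f : EuclideanSpace ℝ V,
      ⟪(√r)⁻¹ • WithLp.toLp 2 z, f⟫_ℝ ^ 2 = (∑ v, z v * f v) ^ 2 / r := by
    intro z r hr f
    rw [inner_smul_left, mul_pow, EuclideanSpace.inner_eq_star_dotProduct]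
    simp [dotProduct, Real.sq_sqrt hr.le, mul_comm, div_eq_mul_inv]
  have hnorm : ∀ (z : V → ℝ) {r : ℝ}, 0 < r →
      ‖(√r)⁻¹ • (WithLp.toLp 2 z : EuclideanSpace ℝ V)‖ ^ 2 = (∑ v, z v * z v) / r := by
    intro z r hr
    rw [norm_smul, mul_pow, EuclideanSpace.norm_sq_eq]
    simp [mul_comm, div_eq_mul_inv, sq]
    simp [← sq, Real.sq_sqrt hr.le]
  rw [← hnorm x hp, ← hnorm y hq]
  refine norm_sq_add_norm_sq_le_of_inner_sq_le hn b (μ := G.laplacianEigenvalue)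
    (G.isHermitian_lapMatrix ℝ).eigenvalues₀_antitone _ _ fun f => ?_
  rw [hinner x hp, hinner y hq, ← hb]
  exact h f

/-! ### Rows of the Laplacian matrix -/

theorem lapMatrix_apply (u x : V) :
    G.lapMatrix ℝ u x = (if u = x then (G.degree u : ℝ) else 0) - if G.Adj u x then 1 else 0 := by
  simp [lapMatrix, degMatrix, diagonal_apply, adjMatrix_apply]

theorem sum_lapMatrix_mul (u : V) (f : V → ℝ) :
    ∑ x, G.lapMatrix ℝ u x * f x = ∑ x ∈ G.neighborFinset u, (f u - f x) := by
  rw [sum_sub_distrib, sum_const, card_neighborFinset_eq_degree, nsmul_eq_mul,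
    ← lapMatrix_mulVec_apply]
  rfl

theorem sum_lapMatrix_mul_self (u : V) :
    ∑ x, G.lapMatrix ℝ u x * G.lapMatrix ℝ u x = (G.degree u : ℝ) ^ 2 + G.degree u := by
  rw [sum_lapMatrix_mul]
  have : ∀ x ∈ G.neighborFinset u,
      G.lapMatrix ℝ u u - G.lapMatrix ℝ u x = (G.degree u : ℝ) + 1 := by
    intro x hx
    rw [mem_neighborFinset] at hx
    simp [lapMatrix_apply, hx, hx.ne]
  rw [sum_congr rfl this]
  simp
  ring

theorem sum_lapMatrix_mul_of_adj {u v : V} (h : G.Adj u v) :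
    -(G.degree u : ℝ) - G.degree v ≤ ∑ x, G.lapMatrix ℝ u x * G.lapMatrix ℝ v x := by
  rw [sum_lapMatrix_mul]
  have hle : ∑ x ∈ G.neighborFinset u, (-1 - if x = v then (G.degree v : ℝ) else 0) ≤
      ∑ x ∈ G.neighborFinset u, (G.lapMatrix ℝ v u - G.lapMatrix ℝ v x) := by
    refine sum_le_sum fun x _ => ?_
    simp only [lapMatrix_apply, h.ne', h.symm, if_false, if_true, eq_comm (a := v) (b := x)]
    split_ifs <;> linarith
  refine le_trans (le_of_eq ?_) hle
  simp [sum_sub_distrib, h]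

/-! ### Edges at two vertices -/

/-- The edges at `u` or `v` carry at most the whole form; the edge `uv`, if present, lies in both
stars and is counted once. -/
theorem starForm_add_starForm_le (f : V → ℝ) {u v : V} (huv : u ≠ v) :
    G.starForm u f + G.starForm v f - (if G.Adj u v then (f u - f v) ^ 2 else 0) ≤
      G.laplacianForm f := by
  set t : V → V → ℝ := fun i j => if G.Adj i j then (f i - f j) ^ 2 else 0 with ht
  have hrow : ∀ i, G.starForm i f = ∑ j, t i j := by
    intro i
    simp [starForm, ht, ← sum_filter, neighborFinset_eq_filter]
  have hsymm : ∀ i j, t i j = t j i := by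
    intro i j
    simp only [ht, G.adj_comm i j]
    split_ifs <;> ring
  have hnn : ∀ i j, 0 ≤ t i j := by
    intro i j
    simp only [ht]
    split_ifs <;> positivity
  have hdiag : ∀ i, t i i = 0 := by simp [ht]
  have hsplit : ∀ g : V → ℝ, ∑ i, g i = g u + g v + ∑ i ∈ (univ.erase u).erase v, g i := by
    intro g
    rw [← add_sum_erase univ g (mem_univ u), ← add_sum_erase (univ.erase u) g
      (mem_erase.2 ⟨huv.symm, mem_univ v⟩), add_assoc]
  have hrest : ∑ i ∈ (univ.erase u).erase v, (t u i + t v i) ≤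
      ∑ i ∈ (univ.erase u).erase v, ∑ j, t i j := by
    refine sum_le_sum fun i _ => ?_
    rw [hsymm u i, hsymm v i, ← sum_pair huv]
    exact sum_le_sum_of_subset_of_nonneg (subset_univ _) fun _ _ _ => hnn _ _
  have hu := hsplit (t u)
  have hv := hsplit (t v)
  have hall := hsplit fun i => ∑ j, t i j
  rw [sum_add_distrib] at hrest
  rw [hdiag] at hu hv
  rw [hsymm v u] at hv
  change _ - t u v ≤ (∑ i, ∑ j, t i j) / 2
  rw [hrow, hrow]
  linarith

theorem starForm_le (f : V → ℝ) {u v : V} (huv : u ≠ v) : G.starForm u f ≤ G.laplacianForm f := by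
  have h := G.starForm_add_starForm_le f huv
  have hv : (if G.Adj u v then (f u - f v) ^ 2 else 0) ≤ G.starForm v f := by
    split_ifs with hadj
    · rw [← neg_sub (f v), neg_sq]
      exact single_le_sum (f := fun x => (f v - f x) ^ 2) (fun _ _ => sq_nonneg _)
        ((G.mem_neighborFinset v u).2 hadj.symm)
    · exact sum_nonneg fun _ _ => sq_nonneg _
  linarith

/-- Cauchy-Schwarz over the edges at `u` other than `uv`. -/
theorem sum_sub_sub_sq_le_of_adj (f : V → ℝ) {u v : V} (h : G.Adj u v) :
    ((∑ x ∈ G.neighborFinset u, (f u - f x)) - (f u - f v)) ^ 2 ≤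
      ((G.degree u : ℝ) - 1) * (G.starForm u f - (f u - f v) ^ 2) := by
  have hv : v ∈ G.neighborFinset u := (G.mem_neighborFinset u v).2 h
  have hcard : (((G.neighborFinset u).erase v).card : ℝ) = (G.degree u : ℝ) - 1 := by
    rw [card_erase_of_mem hv, card_neighborFinset_eq_degree,
      Nat.cast_pred ((G.degree_pos_iff_exists_adj u).2 ⟨v, h⟩)]
  rw [starForm, ← add_sum_erase _ _ hv, ← add_sum_erase _ _ hv, ← hcard, add_sub_cancel_left,
    add_sub_cancel_left]
  exact sq_sum_le_card_mul_sum_sq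

/-! ### Lower bounds for the two largest eigenvalues -/

/-- For non-adjacent `u`, `v` the stars at `u` and `v` have disjoint edge sets, so the corresponding
edge vectors are orthogonal; they contribute `d(u) + 1` and `d(v) + 1`. -/
theorem degree_add_degree_add_two_le (hn : 2 ≤ Fintype.card V) {u v : V} (huv : u ≠ v)
    (h : ¬ G.Adj u v) (hu : 0 < G.degree u) (hv : 0 < G.degree v) :
    (G.degree u : ℝ) + G.degree v + 2 ≤
      G.laplacianEigenvalue ⟨0, by omega⟩ + G.laplacianEigenvalue ⟨1, by omega⟩ := by
  have hu' : (0 : ℝ) < G.degree u := by exact_mod_cast hu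
  have hv' : (0 : ℝ) < G.degree v := by exact_mod_cast hv
  refine le_trans (le_of_eq ?_) (G.le_laplacianEigenvalue_add hn (G.lapMatrix ℝ u)
    (G.lapMatrix ℝ v) hu' hv' fun f => ?_)
  · rw [sum_lapMatrix_mul_self, sum_lapMatrix_mul_self]
    field_simp
    ring
  · rw [sum_lapMatrix_mul, sum_lapMatrix_mul]
    have h1 := G.starForm_add_starForm_le f huv
    rw [if_neg h] at h1
    have h2 := (div_le_iff₀' hu').2 (G.sum_sub_sq_le f u)
    have h3 := (div_le_iff₀' hv').2 (G.sum_sub_sq_le f v)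
    linarith

/-- Bessel's inequality for the edge vectors `z` and `z + D w`, where `z`, `w` are the outward stars
at adjacent vertices `u`, `v` of degrees `D`, `E`. Here `P` and `R` are the pairings of a vector on
the edges with `z` and `w`, `g` is its value on `uv` oriented from `u`, and `S`, `T` are its squared
norms on the two stars. As `z` and `w` have squared norms `D`, `E` and inner product `-1`, the vector
`z + D w` is orthogonal to `z` and has squared norm `D (D E - 1)`. -/
theorem sq_div_add_sq_div_le {D E P R S T g : ℝ} (hD : 1 < D) (hE : 1 < E)
    (hS : (P - g) ^ 2 ≤ (D - 1) * (S - g ^ 2)) (hT : (R + g) ^ 2 ≤ (E - 1) * (T - g ^ 2)) :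
    P ^ 2 / D + (P + D * R) ^ 2 / (D * (D * E - 1)) ≤ S + T - g ^ 2 := by
  have hDE : 0 < D * E - 1 := by nlinarith
  have hD1 : 0 < D - 1 := by linarith
  have hE1 : 0 < E - 1 := by linarith
  have hS' := (div_le_iff₀' hD1).2 hS
  have hT' := (div_le_iff₀' hE1).2 hT
  have hD0 : D ≠ 0 := by positivity
  -- The gap, as a quadratic in `g`, is a perfect square.
  have key : (P - g) ^ 2 / (D - 1) + (R + g) ^ 2 / (E - 1) + g ^ 2 -
      (P ^ 2 / D + (P + D * R) ^ 2 / (D * (D * E - 1))) =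
      ((D * E - 1) * g - (E - 1) * P + (D - 1) * R) ^ 2 / ((D - 1) * (E - 1) * (D * E - 1)) := by
    field_simp
    ring
  have : 0 ≤ ((D * E - 1) * g - (E - 1) * P + (D - 1) * R) ^ 2 /
      ((D - 1) * (E - 1) * (D * E - 1)) := by positivity
  linarith

/-- For adjacent `u`, `v` of degrees `D`, `E ≥ 2` the orthogonalised stars `z` and `z + D w` of
`sq_div_add_sq_div_le` give strict inequality. Their images are the row `r` of the Laplacian matrix
at `u` and `r + D s`, with `s` the row at `v`; the first contributes `D + 1`, and the second more
than `E`, with an excess of at least `(D - 1) (E - 1) / (D E - 1)`. -/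
theorem degree_add_degree_add_one_lt (hn : 2 ≤ Fintype.card V) {u v : V}
    (h : G.Adj u v) (hu : 2 ≤ G.degree u) (hv : 2 ≤ G.degree v) :
    (G.degree u : ℝ) + G.degree v + 1 <
      G.laplacianEigenvalue ⟨0, by omega⟩ + G.laplacianEigenvalue ⟨1, by omega⟩ := by
  have hD : (2 : ℝ) ≤ G.degree u := by exact_mod_cast hu
  have hE : (2 : ℝ) ≤ G.degree v := by exact_mod_cast hv
  have huv := G.sum_lapMatrix_mul_of_adj h
  have hu1 := fun f => G.sum_sub_sub_sq_le_of_adj f h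
  have hv1 := fun f => G.sum_sub_sub_sq_le_of_adj f h.symm
  have hu2 := G.sum_lapMatrix_mul_self u
  have hv2 := G.sum_lapMatrix_mul_self v
  set D : ℝ := ((G.degree u : ℕ) : ℝ)
  set E : ℝ := ((G.degree v : ℕ) : ℝ)
  have hD0 : 0 < D := by linarith
  have hDE : 0 < D * E - 1 := by nlinarith
  have hsum : ∀ f : V → ℝ, ∑ x, (G.lapMatrix ℝ u x + D * G.lapMatrix ℝ v x) * f x =
      ∑ x, G.lapMatrix ℝ u x * f x + D * ∑ x, G.lapMatrix ℝ v x * f x := by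
    intro f
    simp only [add_mul, sum_add_distrib, mul_sum, mul_assoc]
  refine lt_of_lt_of_le ?_ (G.le_laplacianEigenvalue_add hn (G.lapMatrix ℝ u)
    (fun x => G.lapMatrix ℝ u x + D * G.lapMatrix ℝ v x) hD0 (mul_pos hD0 hDE) fun f => ?_)
  · have hnorm : ∑ x, (G.lapMatrix ℝ u x + D * G.lapMatrix ℝ v x) *
        (G.lapMatrix ℝ u x + D * G.lapMatrix ℝ v x) =
        D ^ 2 + D + 2 * D * (∑ x, G.lapMatrix ℝ u x * G.lapMatrix ℝ v x) +
          D ^ 2 * (E ^ 2 + E) := by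
      rw [← hu2, ← hv2]
      simp only [mul_sum, ← sum_add_distrib]
      exact sum_congr rfl fun x _ => by ring
    have h1 : (D ^ 2 + D) / D = D + 1 := by field_simp
    have h2 : E < (D ^ 2 + D + 2 * D * (∑ x, G.lapMatrix ℝ u x * G.lapMatrix ℝ v x) +
          D ^ 2 * (E ^ 2 + E)) / (D * (D * E - 1)) := by
      rw [lt_div_iff₀ (mul_pos hD0 hDE)]
      have h3 : 0 < D * ((D - 1) * (E - 1)) :=
        mul_pos hD0 (mul_pos (by linarith) (by linarith))
      have h4 := mul_le_mul_of_nonneg_left huv hD0.le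
      linarith
    rw [hnorm, hu2, h1]
    linarith
  · rw [hsum, sum_lapMatrix_mul, sum_lapMatrix_mul]
    have h1 := G.starForm_add_starForm_le f h.ne
    rw [if_pos h] at h1
    have hv1 := hv1 f
    rw [← neg_sub (f u) (f v), neg_sq, sub_neg_eq_add] at hv1
    exact (sq_div_add_sq_div_le (by linarith) (by linarith) (hu1 f) hv1).trans h1

/-- The star at `u` and the difference of two of its edges are orthogonal edge vectors, contributing
`d(u) + 1` and `1`. -/
theorem degree_add_two_le (hn : 2 ≤ Fintype.card V) {u x y : V} (hxy : x ≠ y)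
    (hx : G.Adj u x) (hy : G.Adj u y) :
    (G.degree u : ℝ) + 2 ≤
      G.laplacianEigenvalue ⟨0, by omega⟩ + G.laplacianEigenvalue ⟨1, by omega⟩ := by
  have hD0 : (0 : ℝ) < G.degree u := by
    exact_mod_cast (G.degree_pos_iff_exists_adj u).2 ⟨x, hx⟩
  let w : V → ℝ := fun z => (if z = y then 1 else 0) - if z = x then 1 else 0
  have hw : ∀ f : V → ℝ, ∑ z, w z * f z = f y - f x := by
    intro f
    simp [w, sub_mul, sum_sub_distrib]
  refine le_trans (le_of_eq ?_) (G.le_laplacianEigenvalue_add hn (G.lapMatrix ℝ u)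
    w hD0 two_pos fun f => ?_)
  · rw [sum_lapMatrix_mul_self, hw]
    simp only [w, hxy, hxy.symm, if_true, if_false]
    field_simp
    ring
  · rw [sum_lapMatrix_mul, hw]
    refine le_trans ?_ (G.starForm_le f hx.ne)
    -- Bessel's inequality: subtract from `f u - f z` its mean `m` over the neighbours `z` of `u`.
    set P := ∑ z ∈ G.neighborFinset u, (f u - f z) with hP
    set m := P / G.degree u with hm
    have hvar : ∑ z ∈ G.neighborFinset u, (f u - f z - m) ^ 2 =
        G.starForm u f - P ^ 2 / G.degree u := by
      have hexp : ∀ z, (f u - f z - m) ^ 2 = (f u - f z) ^ 2 - 2 * m * (f u - f z) + m ^ 2 :=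
        fun z => by ring
      simp only [hexp, sum_add_distrib]
      rw [sum_sub_distrib, ← mul_sum, ← hP, sum_const, card_neighborFinset_eq_degree,
        nsmul_eq_mul, starForm, hm]
      field_simp
      ring
    have hpair : (f u - f x - m) ^ 2 + (f u - f y - m) ^ 2 ≤
        ∑ z ∈ G.neighborFinset u, (f u - f z - m) ^ 2 := by
      rw [← sum_pair (f := fun z => (f u - f z - m) ^ 2) hxy]
      refine sum_le_sum_of_subset_of_nonneg ?_ fun _ _ _ => sq_nonneg _
      simp [insert_subset_iff, hx, hy]
    nlinarith [sq_nonneg ((f u - f x - m) + (f u - f y - m))]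

/-! ### The star -/

theorem laplacianForm_starGraph (c : V) [DecidableRel (starGraph c).Adj] (f : V → ℝ) :
    (starGraph c).laplacianForm f = ∑ x, (f x - f c) ^ 2 := by
  have hrow : ∀ i, (∑ j, if (starGraph c).Adj i j then (f i - f j) ^ 2 else 0) =
      (f i - f c) ^ 2 + if i = c then ∑ j, (f j - f c) ^ 2 else 0 := by
    intro i
    by_cases hi : i = c
    · subst hi
      simp only [starGraph_adj, true_or, and_true, if_true, sub_self, ne_eq, OfNat.ofNat_ne_zero,
        not_false_eq_true, zero_pow, zero_add]
      refine sum_congr rfl fun j _ => ?_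
      by_cases h : i = j
      · simp [h]
      · rw [if_pos h]
        ring
    · rw [if_neg hi, add_zero, sum_eq_single c]
      · simp [hi]
      · intro j _ hj
        simp [hi, hj]
      · simp
  simp only [laplacianForm, hrow, sum_add_distrib, sum_ite_eq', mem_univ, if_true]
  ring

/-- The two largest Laplacian eigenvalues of the star on `n` vertices are at most `n` and `1`. -/
theorem laplacianEigenvalue_add_le_of_starGraph (hn : 2 ≤ Fintype.card V) (c : V)
    [DecidableRel (starGraph c).Adj] :
    (starGraph c).laplacianEigenvalue ⟨0, by omega⟩ +
      (starGraph c).laplacianEigenvalue ⟨1, by omega⟩ ≤ Fintype.card V + 1 := by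
  obtain ⟨b, hb⟩ := (starGraph c).exists_orthonormalBasis_laplacianForm
  set i₀ : Fin (Fintype.card V) := ⟨0, by omega⟩
  set i₁ : Fin (Fintype.card V) := ⟨1, by omega⟩
  set μ := (starGraph c).laplacianEigenvalue
  have hμ : μ i₁ ≤ μ i₀ := ((starGraph c).isHermitian_lapMatrix ℝ).eigenvalues₀_antitone
    (by simp [i₀, i₁, Fin.le_def])
  have hne : i₀ ≠ i₁ := by simp [i₀, i₁]
  have hcomb : ∀ s t : ℝ, (starGraph c).laplacianForm (s • b i₀ + t • b i₁ : EuclideanSpace ℝ V) =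
      μ i₀ * s ^ 2 + μ i₁ * t ^ 2 := by
    intro s t
    rw [hb, sum_eq_add i₀ i₁ hne]
    · simp [inner_add_right, inner_smul_right, b.inner_eq_ite, hne, hne.symm]
    · intro j _ hj
      simp [inner_add_right, inner_smul_right, b.inner_eq_ite, hj.1, hj.2]
    · simp
    · simp
  have hnorm : ∀ s t : ℝ, ∑ x, (s • b i₀ + t • b i₁ : EuclideanSpace ℝ V) x ^ 2 =
      s ^ 2 + t ^ 2 := by
    intro s t
    rw [← EuclideanSpace.real_norm_sq_eq, norm_add_sq_real]
    simp [norm_smul, inner_smul_right, inner_smul_left, b.inner_eq_ite, hne]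
  have htop : μ i₀ ≤ Fintype.card V := by
    have h1 := hcomb 1 0
    have h2 := hnorm 1 0
    simp only [one_smul, zero_smul, add_zero, one_pow, mul_one, ne_eq, OfNat.ofNat_ne_zero,
        not_false_eq_true, zero_pow, mul_zero, laplacianForm_starGraph] at h1 h2
    rw [← h1, ← mul_one (Fintype.card V : ℝ), ← h2]
    set f := b i₀
    -- After expanding, the claim is Cauchy-Schwarz over the leaves together with
    -- `0 ≤ (f c + ∑ leaves) ^ 2`.
    have hcs := sq_sum_le_card_mul_sum_sq (s := univ.erase c) (f := f)
    have hs := add_sum_erase univ (fun x => f x) (mem_univ c)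
    have hq := add_sum_erase univ (fun x => f x ^ 2) (mem_univ c)
    have hcard : ((univ.erase c).card : ℝ) = Fintype.card V - 1 := by
      rw [card_erase_of_mem (mem_univ c), card_univ, Nat.cast_pred (by omega)]
    have hexp : ∑ x, (f x - f c) ^ 2 = ∑ x, f x ^ 2 - 2 * f c * ∑ x, f x +
        Fintype.card V * f c ^ 2 := by
      have : ∀ x, (f x - f c) ^ 2 = f x ^ 2 - 2 * f c * f x + f c ^ 2 := fun x => by ring
      simp only [this, sum_add_distrib, sum_sub_distrib, ← mul_sum, sum_const, card_univ,
        nsmul_eq_mul]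
    rw [hexp, ← hs, ← hq]
    rw [hcard] at hcs
    nlinarith [sq_nonneg (f c + ∑ x ∈ univ.erase c, f x)]
  -- On vectors vanishing at the centre the form is the squared norm, and the span of the two top
  -- eigenvectors contains such a vector.
  have hsecond : μ i₁ ≤ 1 := by
    have hval : ∀ s t : ℝ, s * b i₀ c + t * b i₁ c = 0 →
        μ i₀ * s ^ 2 + μ i₁ * t ^ 2 = s ^ 2 + t ^ 2 := by
      intro s t hst
      rw [← hcomb, ← hnorm, laplacianForm_starGraph]
      refine sum_congr rfl fun x _ => ?_
      simp [hst]
    by_cases h0 : b i₀ c = 0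
    · have := hval 1 0 (by simp [h0])
      linarith
    · have := hval (b i₁ c) (-b i₀ c) (by ring)
      have hpos : 0 < b i₀ c ^ 2 := by positivity
      nlinarith [mul_nonneg (sub_nonneg.2 hμ) (sq_nonneg (b i₁ c))]
  linarith

/-! ### Vertices of largest degree -/

/-- The two largest entries of the degree sequence are attained at two distinct vertices. -/
theorem exists_degree_eq_degreeSeq (hn : 2 ≤ Fintype.card V) :
    ∃ u v, u ≠ v ∧ G.degree u = G.degreeSeq ⟨0, by omega⟩ ∧ G.degree v = G.degreeSeq ⟨1, by omega⟩ ∧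
      G.degree v ≤ G.degree u ∧ ∀ w, w ≠ u → G.degree w ≤ G.degree v := by
  have hsort : G.degreeList.Pairwise (· ≥ ·) := Multiset.pairwise_sort _ _
  have hcoe : (G.degreeList : Multiset ℕ) = univ.val.map fun v => G.degree v :=
    Multiset.sort_eq _ _
  have hlen := G.length_degreeList
  obtain ⟨d₀, d₁, rest, hl⟩ : ∃ d₀ d₁ rest, G.degreeList = d₀ :: d₁ :: rest := by
    match G.degreeList, hlen with
    | [], hlen => simp at hlen; omega
    | [_], hlen => simp at hlen; omega
    | d₀ :: d₁ :: rest, _ => exact ⟨d₀, d₁, rest, rfl⟩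
  have h0 : G.degreeSeq ⟨0, by omega⟩ = d₀ := by simp [degreeSeq, hl]
  have h1 : G.degreeSeq ⟨1, by omega⟩ = d₁ := by simp [degreeSeq, hl]
  rw [h0, h1]
  rw [hl] at hsort hcoe
  have hmem : d₀ ∈ univ.val.map fun v => G.degree v := by simp [← hcoe]
  obtain ⟨u, -, hu⟩ := Multiset.mem_map.1 hmem
  have herase : ((univ.erase u).val.map fun v => G.degree v) = (d₁ :: rest : List ℕ) := by
    have h1 := hcoe
    rw [← insert_erase (mem_univ u), insert_val_of_notMem (notMem_erase u _),
      Multiset.map_cons, hu, ← Multiset.cons_coe] at h1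
    exact ((Multiset.cons_inj_right _).1 h1).symm
  have hmem' : d₁ ∈ (univ.erase u).val.map fun v => G.degree v := by rw [herase]; simp
  obtain ⟨v, hv, hvd⟩ := Multiset.mem_map.1 hmem'
  rw [List.pairwise_cons, List.pairwise_cons] at hsort
  refine ⟨u, v, (ne_of_mem_erase hv).symm, hu, hvd, ?_,
    fun w hw => ?_⟩
  · rw [hu, hvd]
    exact hsort.1 d₁ (by simp)
  · have hwm : G.degree w ∈ (univ.erase u).val.map fun v => G.degree v :=
      Multiset.mem_map_of_mem _ (show w ∈ univ.erase u from mem_erase.2 ⟨hw, mem_univ w⟩)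
    rw [herase, Multiset.mem_coe, List.mem_cons] at hwm
    rw [hvd]
    exact hwm.elim le_of_eq (hsort.2.1 _)

/-- Each neighbour of `u` is a leaf, so no walk from `u` leaves the closed neighbourhood of `u`. -/
theorem Connected.eq_starGraph_of_degree_le_one {G : SimpleGraph V} [DecidableRel G.Adj]
    (hG : G.Connected) {u : V} (h : ∀ w, w ≠ u → G.degree w ≤ 1) : G = starGraph u := by
  have huniq : ∀ {w x y}, w ≠ u → G.Adj w x → G.Adj w y → x = y := by
    intro w x y hw hx hy
    exact card_le_one.1 (h w hw) x ((G.mem_neighborFinset w x).2 hx) y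
      ((G.mem_neighborFinset w y).2 hy)
  have hstep : ∀ w, G.Reachable u w → w = u ∨ G.Adj u w := by
    intro w hw
    rw [reachable_iff_reflTransGen] at hw
    induction hw with
    | refl => exact Or.inl rfl
    | @tail x y _ hxy ih =>
      by_cases hx : x = u
      · exact Or.inr (hx ▸ hxy)
      · exact Or.inl (huniq hx hxy (ih.resolve_left hx).symm)
  ext x y
  rw [starGraph_adj]
  constructor
  · intro hxy
    refine ⟨hxy.ne, or_iff_not_imp_left.2 fun hx => ?_⟩
    exact huniq hx hxy ((hstep x (hG u x)).resolve_left hx).symm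
  · rintro ⟨hne, rfl | rfl⟩
    · exact (hstep y (hG _ y)).resolve_left hne.symm
    · exact ((hstep x (hG _ x)).resolve_left hne).symm

end SimpleGraph

/-! ### The sum of the two largest Laplacian eigenvalues -/

open SimpleGraph in
theorem theorem1 {V : Type*} [Fintype V] [DecidableEq V]
    (G : SimpleGraph V) [DecidableRel G.Adj]
    (hconn : G.Connected) (hn : 3 ≤ Fintype.card V) :
    ((G.degreeSeq ⟨0, by omega⟩ : ℝ) + (G.degreeSeq ⟨1, by omega⟩ : ℝ) + 1 ≤
      G.laplacianEigenvalue ⟨0, by omega⟩ + G.laplacianEigenvalue ⟨1, by omega⟩) ∧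
    (G.laplacianEigenvalue ⟨0, by omega⟩ + G.laplacianEigenvalue ⟨1, by omega⟩ =
        (G.degreeSeq ⟨0, by omega⟩ : ℝ) + (G.degreeSeq ⟨1, by omega⟩ : ℝ) + 1 ↔
      ∃ c : V, G = SimpleGraph.starGraph c) := by
  have hn2 : 2 ≤ Fintype.card V := by omega
  obtain ⟨u, v, huv, hu, hv, hvu, hle⟩ := G.exists_degree_eq_degreeSeq hn2
  rw [← hu, ← hv]
  have : Nontrivial V := ⟨u, v, huv⟩
  have hpos : ∀ w, 0 < G.degree w := fun w => hconn.preconnected.degree_pos_of_nontrivial w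
  -- If the second largest degree is `1` the graph is a star and equality holds; otherwise the
  -- inequality is strict.
  by_cases hone : G.degree v = 1
  · have hstar : G = starGraph u :=
      hconn.eq_starGraph_of_degree_le_one fun w hw => (hle w hw).trans hone.le
    have hadj : ∀ w, w ≠ u → G.Adj u w := by
      intro w hw
      rw [hstar]
      simp [hw.symm]
    have hdeg : G.degree u + 1 = Fintype.card V := by
      have : G.neighborFinset u = Finset.univ.erase u := by
        ext w
        simp only [mem_neighborFinset, Finset.mem_erase, Finset.mem_univ, and_true]
        exact ⟨fun h => h.ne', hadj w⟩
      rw [← card_neighborFinset_eq_degree, this, Finset.card_erase_of_mem (Finset.mem_univ u),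
        Finset.card_univ]
      omega
    obtain ⟨x, hx, y, hy, hxy⟩ := Finset.one_lt_card.1
      (show 1 < (G.neighborFinset u).card by rw [card_neighborFinset_eq_degree]; omega)
    have hlow := G.degree_add_two_le hn2 hxy ((G.mem_neighborFinset u x).1 hx)
      ((G.mem_neighborFinset u y).1 hy)
    have hup : G.laplacianEigenvalue ⟨0, by omega⟩ + G.laplacianEigenvalue ⟨1, by omega⟩ ≤
        Fintype.card V + 1 := by
      subst hstar
      exact laplacianEigenvalue_add_le_of_starGraph hn2 u
    have hdeg' : (G.degree u : ℝ) + 1 = Fintype.card V := by exact_mod_cast hdeg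
    rw [hone, Nat.cast_one]
    exact ⟨by linarith, fun _ => ⟨u, hstar⟩, fun _ => by linarith⟩
  · have hlt : (G.degree u : ℝ) + G.degree v + 1 <
        G.laplacianEigenvalue ⟨0, by omega⟩ + G.laplacianEigenvalue ⟨1, by omega⟩ := by
      have hv2 : 2 ≤ G.degree v := by have := hpos v; omega
      by_cases hadj : G.Adj u v
      · exact G.degree_add_degree_add_one_lt hn2 hadj (hv2.trans hvu) hv2
      · linarith [G.degree_add_degree_add_two_le hn2 huv hadj (hpos u) (hpos v)]
    refine ⟨hlt.le, fun h => absurd h hlt.ne', ?_⟩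
    rintro ⟨c, hc⟩
    have hleaf : ∀ w, w ≠ c → G.degree w = 1 := by
      subst hc
      intro w hw
      convert degree_starGraph_of_ne_center hw
    have huc : u = c := by
      by_contra h
      have := hleaf u h
      have := hpos v
      omega
    exact absurd (hleaf v fun h => huv (huc.trans h.symm)) hone
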